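/- Let $p$ be a prime, $q>1$ a power of $p$, and let $\wp\in\mathbb{F}_q[t]$ be an irreducible polynomial. Let $K_\wp$ be the $\wp$-adic completion of $\mathbb{F}_q(t)$, let $\mathbb{C}_\wp$ be the completion of an algebraic closure of $K_\wp$, and let $v_\wp:\mathbb{C}_\wp\to\mathbb{Q}\cup\{+\infty\}$ be the additive valuation normalized by $v_\wp(\wp)=1$. Let $E/K_\wp$ be a finite extension inside $\mathbb{C}_\wp$ and $\mathcal{O}_E$ its ring of integers. For $B\in M_L(\mathcal{O}_E)$, the elementary divisors $s_1\le s_2\le\cdots\le s_L$ of $B$ are the valuations $v_\wp$ of the diagonal entries of a Smith normal form of $B$ over $\mathcal{O}_E$; and for a rational number $a$, $d(B,a)$ denotes the number, counted with (algebraic) multiplicity, of eigenvalues $\lambda\in\mathbb{C}_\wp$ of $B$ of slope $v_\wp(\lambda)=a$. Let $d_0$, $n$ and $L$ be positive integers. Let $B\in M_L(\mathcal{O}_E)$ be a matrix whose elementary divisors satisfy $s_i\ge\left\lfloor\frac{i-1}{d_0}\right\rfloor$ for every $1\le i\le L$. Put $\varepsilon_0=d(B,0)$ and $$C_1(n,d_0,\varepsilon_0)=p^n\left(\frac{4+d_0p^n-d_0}{4+2d_0p^n-2\varepsilon_0}\right).$$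 Put $q_1=r_1=0$ and, for $l\ge 2$, $q_l=\left\lfloor\frac{l-2}{d_0}\right\rfloor$ and $r_l=l-2-d_0q_l$. Put $$C_2(n,d_0,\varepsilon_0)=\min\left\{\frac{2p^n+d_0q_l(q_l-1)+2q_l(r_l+1)}{2(l-\varepsilon_0)}\ \middle|\ l\in\mathbb{Z},\ \varepsilon_0<l\le 1+d_0p^n\right\}$$ and $$C(n,d_0,\varepsilon_0)=\min\{C_1(n,d_0,\varepsilon_0),C_2(n,d_0,\varepsilon_0)\}.$$ Then $C_1(n,d_0,\varepsilon_0)\in(0,p^n)$ and $C(n,d_0,\varepsilon_0)\in(0,p^n)$. Moreover, for every matrix $B'\in M_L(\mathcal{O}_E)$ with $B'-B\in\wp^{p^n}M_L(\mathcal{O}_E)$ and every rational number $a$ with $0\le a<C(n,d_0,\varepsilon_0)$, we have $$d(B,a)=d(B',a).$$ -/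

import Mathlib

open Polynomial
open scoped NNReal WithZero

noncomputable section

namespace DrinfeldSlopes

variable {F : Type*} [Field F]

/-- The place of `F(t)` attached to an irreducible polynomial `P ∈ F[t]`. -/
def place (P : F[X]) [hP : Fact (Irreducible P)] : IsDedekindDomain.HeightOneSpectrum F[X] where
  asIdeal := Ideal.span {P}
  isPrime := (Ideal.span_singleton_prime hP.out.ne_zero).2 hP.out.prime
  ne_bot := by simpa using hP.out.ne_zero

/-- `K_℘`: the `℘`-adic completion of `K = F(t)`, where `℘ = P`. -/
abbrev LocalFld (P : F[X]) [Fact (Irreducible P)] : Type _ :=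
  (place P).adicCompletion (RatFunc F)

/-- A real-valued embedding of the value group of `K_℘`, with base `2`. The base is immaterial:
the valuation `valWp` below is normalized. -/
instance (P : F[X]) [Fact (Irreducible P)] :
    (Valued.v : Valuation (LocalFld P) ℤᵐ⁰).RankOne :=
  Valuation.IsRankOneDiscrete.rankOne (Valued.v : Valuation (LocalFld P) ℤᵐ⁰)
    (one_lt_two : (1 : ℝ≥0) < 2)

/-- The `℘`-adic absolute value on `K_℘`. -/
instance (P : F[X]) [Fact (Irreducible P)] : NontriviallyNormedField (LocalFld P) :=
  Valued.toNontriviallyNormedField (L := LocalFld P) (Γ₀ := ℤᵐ⁰)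

instance (P : F[X]) [Fact (Irreducible P)] : IsUltrametricDist (LocalFld P) :=
  IsUltrametricDist.isUltrametricDist_of_forall_norm_add_le_max_norm
    (Valuation.norm_add_le (Valued.v : Valuation (LocalFld P) ℤᵐ⁰))

/-- An algebraic closure of `K_℘`. -/
abbrev AlgCl (P : F[X]) [Fact (Irreducible P)] : Type _ := AlgebraicClosure (LocalFld P)

/-- The unique extension of the `℘`-adic absolute value to the algebraic closure of `K_℘`. -/
instance (P : F[X]) [Fact (Irreducible P)] : NormedField (AlgCl P) :=
  spectralNorm.normedField (LocalFld P) (AlgCl P)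

instance (P : F[X]) [Fact (Irreducible P)] : NormedAlgebra (LocalFld P) (AlgCl P) :=
  spectralNorm.normedAlgebra (LocalFld P) (AlgCl P)

/-- `ℂ_℘`: the completion of an algebraic closure of `K_℘`. -/
abbrev Cwp (P : F[X]) [Fact (Irreducible P)] : Type _ := UniformSpace.Completion (AlgCl P)

instance (P : F[X]) [Fact (Irreducible P)] : IsUltrametricDist (Cwp P) :=
  IsUltrametricDist.of_normedAlgebra (LocalFld P)

/-- The element `℘` of `K_℘`. -/
def wp (P : F[X]) [Fact (Irreducible P)] : LocalFld P := algebraMap F[X] (LocalFld P) P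

variable {P : F[X]} [Fact (Irreducible P)]

open Classical in
/-- The additive valuation `v_℘` on `ℂ_℘`, normalized by `v_℘(℘) = 1`, with `v_℘(0) = +∞`. -/
def valWp (x : Cwp P) : WithTop ℝ := if x = 0 then ⊤ else (Real.logb ‖wp P‖ ‖x‖ : ℝ)

/-- The ring of integers `𝒪_E` of a subextension `E` of `ℂ_℘ / K_℘`: the elements of absolute
value at most one, i.e. of nonnegative valuation. -/
def ringInt (E : IntermediateField (LocalFld P) (Cwp P)) : Subring E :=
  ((NormedField.valuation (K := Cwp P)).comap (algebraMap E (Cwp P))).integer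

variable {E : IntermediateField (LocalFld P) (Cwp P)} {L : ℕ}

/-- `s` is the nondecreasing sequence of elementary divisors of `B ∈ M_L(𝒪_E)`: the normalized
valuations of the diagonal entries of a Smith normal form of `B`. -/
def IsElementaryDivisors (B : Matrix (Fin L) (Fin L) (ringInt E)) (s : Fin L → WithTop ℝ) :
    Prop :=
  Monotone s ∧ ∃ (U V : Matrix.GeneralLinearGroup (Fin L) (ringInt E)) (D : Fin L → ringInt E),
    (U : Matrix (Fin L) (Fin L) (ringInt E)) * B * (V : Matrix (Fin L) (Fin L) (ringInt E)) =
      Matrix.diagonal D ∧ ∀ i, s i = valWp ((D i : E) : Cwp P)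

open Classical in
/-- `d(B, a)`: the number of eigenvalues of `B` in `ℂ_℘` of slope `a`, counted with multiplicity. -/
def slopeMult (B : Matrix (Fin L) (Fin L) (ringInt E)) (a : ℚ) : ℕ :=
  (B.map (fun x => ((x : E) : Cwp P))).charpoly.roots.countP
    (fun lam => valWp lam = ((a : ℝ) : WithTop ℝ))

/-- `B' - B ∈ ℘ ^ m M_L(𝒪_E)`. -/
def CongrModPow (m : ℕ) (B B' : Matrix (Fin L) (Fin L) (ringInt E)) : Prop :=
  ∃ W : Matrix (Fin L) (Fin L) (ringInt E), ∀ i j,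
    ((B' i j : E) - (B i j : E)) = algebraMap (LocalFld P) E (wp P) ^ m * (W i j : E)

/-- `q_l`, with `q_1 = 0`. -/
def qIdx (d₀ l : ℕ) : ℕ := if l = 1 then 0 else (l - 2) / d₀

/-- `r_l`, with `r_1 = 0`. -/
def rIdx (d₀ l : ℕ) : ℕ := if l = 1 then 0 else l - 2 - d₀ * qIdx d₀ l

/-- The constant `C₁(n, d₀, ε₀)`. -/
def constC₁ (p n d₀ ε₀ : ℕ) : ℝ :=
  (p : ℝ) ^ n * ((4 + d₀ * (p : ℝ) ^ n - d₀) / (4 + 2 * d₀ * (p : ℝ) ^ n - 2 * ε₀))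

/-- The constant `C₂(n, d₀, ε₀)`: a minimum over the finite set of `l` with
`ε₀ < l ≤ 1 + d₀ p ^ n`. -/
def constC₂ (p n d₀ ε₀ : ℕ) : ℝ :=
  sInf {x : ℝ | ∃ l : ℕ, ε₀ < l ∧ l ≤ 1 + d₀ * p ^ n ∧
    x = (2 * (p : ℝ) ^ n + d₀ * (qIdx d₀ l : ℝ) * ((qIdx d₀ l : ℝ) - 1)
      + 2 * (qIdx d₀ l : ℝ) * ((rIdx d₀ l : ℝ) + 1)) / (2 * ((l : ℝ) - ε₀))}

/-- The constant `C(n, d₀, ε₀)`. -/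
def constC (p n d₀ ε₀ : ℕ) : ℝ := min (constC₁ p n d₀ ε₀) (constC₂ p n d₀ ε₀)

end DrinfeldSlopes

end

/-! Write `ρ = ‖℘‖ < 1` and `r = ρ ^ a`. For a split polynomial, the first and last indices at which
`‖c_i‖ r ^ i` is maximal are the numbers of roots of norm `< r` and `≤ r` (`exists_isPeak`), so
their difference counts the roots of slope `a`. By the ultrametric inequality, a change of Gauss
norm smaller than the maximum moves neither index (`IsPeak.perturb`). It remains to compare two
sizes for the characteristic polynomial.

The variation is small. If `U B V = D` is a Smith form, then up to a unit the polynomial is `det (X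
U V - D)`, whose column `i` (counted from `0`) has Gauss norm at most `ρ ^ min(a, ⌊i/d₀⌋)`. A change
of `B` by `℘ ^ m W`, with `m = p ^ n`, alters each column by a relative factor `ρ ^ (m - a)` at
most, hence the determinant by at most `ρ ^ (m - a + ∑ min(a, ⌊i/d₀⌋))`.

The peak is high. The `ε₀` unit eigenvalues produce a unit coefficient in degree `L - ε₀`, so the
maximum is at least `ρ ^ (a (L - ε₀))`.

The resulting inequality of exponents (`exponent_lt`) follows from `a < C₂`, by way of the single
term `l = d₀ ⌈a⌉ + 1`. -/

namespace DrinfeldSlopes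

/-! ### Weighted Gauss norms and the location of roots -/

section Gauss

variable {K : Type*} [NormedField K]

/-- All weighted coefficients `‖c_i‖ r ^ i` of `f` are at most `M`. -/
def GaussBound (r : ℝ) (f : K[X]) (M : ℝ) : Prop := ∀ i, ‖f.coeff i‖ * r ^ i ≤ M

/-- The maximal weighted coefficient of `f` is `M`, attained first at `k` and last at `m`. -/
structure IsPeak (r : ℝ) (f : K[X]) (M : ℝ) (k m : ℕ) : Prop where
  bound : GaussBound r f M
  first : ‖f.coeff k‖ * r ^ k = M
  last : ‖f.coeff m‖ * r ^ m = M
  lt_first : ∀ i < k, ‖f.coeff i‖ * r ^ i < M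
  lt_last : ∀ i, m < i → ‖f.coeff i‖ * r ^ i < M

theorem IsPeak.unique {r M M' : ℝ} {f : K[X]} {k m k' m' : ℕ} (h : IsPeak r f M k m)
    (h' : IsPeak r f M' k' m') : M = M' ∧ k = k' ∧ m = m' := by
  have hM : M = M' := le_antisymm (h.first ▸ h'.bound k) (h'.first ▸ h.bound k')
  subst hM
  refine ⟨rfl, ?_, ?_⟩
  · rcases lt_trichotomy k k' with hk | hk | hk
    · exact absurd h.first (h'.lt_first k hk).ne
    · exact hk
    · exact absurd h'.first (h.lt_first k' hk).ne
  · rcases lt_trichotomy m m' with hk | hk | hk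
    · exact absurd h'.last (h.lt_last m' hk).ne
    · exact hk
    · exact absurd h.last (h'.lt_last m hk).ne

theorem GaussBound.nonneg {r M : ℝ} (hr : 0 ≤ r) {f : K[X]} (h : GaussBound r f M) : 0 ≤ M :=
  (mul_nonneg (norm_nonneg _) (pow_nonneg hr 0)).trans (h 0)

theorem GaussBound.mono {r M N : ℝ} {f : K[X]} (h : GaussBound r f M) (hMN : M ≤ N) :
    GaussBound r f N := fun i => (h i).trans hMN

theorem gaussBound_C {r M : ℝ} {x : K} (h : ‖x‖ ≤ M) :
    GaussBound r (C x) M := by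
  intro i
  have hM : 0 ≤ M := (norm_nonneg _).trans h
  rcases i with _ | i
  · simpa using h
  · simpa using hM

theorem gaussBound_X_mul_C {r M : ℝ} (hr : 0 ≤ r) {x : K} (h : ‖x‖ ≤ 1) (hM : r ≤ M) :
    GaussBound r (X * C x) M := by
  intro i
  have h0 : 0 ≤ M := hr.trans hM
  rcases i with _ | _ | i
  · simpa using h0
  · simp only [zero_add, coeff_X_mul, coeff_C_zero, pow_one]
    nlinarith
  · simpa [coeff_C] using h0

theorem GaussBound.units_smul {r M : ℝ} {f : K[X]} (h : GaussBound r f M) (u : ℤˣ) :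
    GaussBound r (u • f) M := by
  intro i
  rcases Int.units_eq_one_or u with rfl | rfl
  · simpa using h i
  · simpa using h i

theorem isPeak_one (r : ℝ) : IsPeak r (1 : K[X]) 1 0 0 := by
  have h : ∀ i, 0 < i → ‖(1 : K[X]).coeff i‖ * r ^ i = 0 := fun i hi => by
    simp [coeff_one, hi.ne']
  refine ⟨fun i => ?_, by simp, by simp, fun i hi => absurd hi (by simp), fun i hi => ?_⟩
  · rcases i.eq_zero_or_pos with rfl | hi
    · simp
    · simp [h i hi]
  · simp [h i hi]

variable [IsUltrametricDist K]

theorem norm_sub_le_max_norm (x y : K) : ‖x - y‖ ≤ max ‖x‖ ‖y‖ := by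
  simpa [sub_eq_add_neg] using IsUltrametricDist.norm_add_le_max x (-y)

theorem GaussBound.add {r M : ℝ} (hr : 0 ≤ r) {f g : K[X]} (hf : GaussBound r f M)
    (hg : GaussBound r g M) : GaussBound r (f + g) M := by
  intro i
  rw [coeff_add]
  calc ‖f.coeff i + g.coeff i‖ * r ^ i
      ≤ max ‖f.coeff i‖ ‖g.coeff i‖ * r ^ i := by
        gcongr
        exact IsUltrametricDist.norm_add_le_max _ _
    _ ≤ M := by
        rw [max_mul_of_nonneg _ _ (pow_nonneg hr i)]
        exact max_le (hf i) (hg i)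

theorem GaussBound.sum {r M : ℝ} (hr : 0 ≤ r) (hM : 0 ≤ M) {ι : Type*} (s : Finset ι)
    {f : ι → K[X]} (h : ∀ i ∈ s, GaussBound r (f i) M) : GaussBound r (∑ i ∈ s, f i) M := by
  classical
  induction s using Finset.induction_on with
  | empty => intro i; simpa using hM
  | insert a s ha ih =>
    rw [Finset.sum_insert ha]
    exact (h a (by simp)).add hr (ih fun i hi => h i (by simp [hi]))

theorem GaussBound.mul {r M N : ℝ} (hr : 0 ≤ r) {f g : K[X]} (hf : GaussBound r f M)
    (hg : GaussBound r g N) : GaussBound r (f * g) (M * N) := by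
  intro i
  have hM := hf.nonneg hr
  have hN := hg.nonneg hr
  obtain ⟨x, hx, hle⟩ := IsUltrametricDist.exists_norm_finsetSum_le_of_nonempty
    (⟨(0, i), by simp⟩ : (Finset.HasAntidiagonal.antidiagonal i).Nonempty) (fun x => f.coeff x.1 * g.coeff x.2)
  rw [coeff_mul]
  calc _ ≤ ‖f.coeff x.1 * g.coeff x.2‖ * r ^ i := by gcongr
    _ = (‖f.coeff x.1‖ * r ^ x.1) * (‖g.coeff x.2‖ * r ^ x.2) := by
        rw [← Finset.HasAntidiagonal.mem_antidiagonal.1 hx, norm_mul, pow_add]; ring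
    _ ≤ M * N := mul_le_mul (hf _) (hg _) (by positivity) hM

theorem GaussBound.prod {r : ℝ} (hr : 0 ≤ r) {ι : Type*} (s : Finset ι)
    {f : ι → K[X]} {b : ι → ℝ} (h : ∀ i ∈ s, GaussBound r (f i) (b i)) :
    GaussBound r (∏ i ∈ s, f i) (∏ i ∈ s, b i) := by
  classical
  induction s using Finset.induction_on with
  | empty => simpa using gaussBound_C (K := K) (x := 1) (M := 1) (by simp)
  | insert a s ha ih =>
    rw [Finset.prod_insert ha, Finset.prod_insert ha]
    exact (h a (by simp)).mul hr (ih fun i hi => h i (by simp [hi]))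

/-- Replacing the factors one at a time changes a single factor at each stage. Since `κ` is the same
relative error for every factor, the ultrametric sum of these changes loses nothing. -/
theorem GaussBound.prod_sub_prod {r κ : ℝ} (hr : 0 ≤ r) (hκ : 0 ≤ κ) {ι : Type*} (s : Finset ι)
    {f g : ι → K[X]} {b : ι → ℝ} (hf : ∀ i ∈ s, GaussBound r (f i) (b i))
    (hg : ∀ i ∈ s, GaussBound r (g i) (b i))
    (hfg : ∀ i ∈ s, GaussBound r (f i - g i) (κ * b i)) :
    GaussBound r (∏ i ∈ s, f i - ∏ i ∈ s, g i) (κ * ∏ i ∈ s, b i) := by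
  classical
  induction s using Finset.induction_on with
  | empty => intro i; simpa using hκ
  | insert a s ha ih =>
    rw [Finset.prod_insert ha, Finset.prod_insert ha, Finset.prod_insert ha]
    have h1 : f a * ∏ i ∈ s, f i - g a * ∏ i ∈ s, g i =
        f a * (∏ i ∈ s, f i - ∏ i ∈ s, g i) + (f a - g a) * ∏ i ∈ s, g i := by ring
    rw [h1]
    refine GaussBound.add hr ?_ ?_
    · refine ((hf a (by simp)).mul hr (ih (fun i hi => hf i (by simp [hi]))
        (fun i hi => hg i (by simp [hi])) (fun i hi => hfg i (by simp [hi])))).mono ?_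
      exact le_of_eq (by ring)
    · refine ((hfg a (by simp)).mul hr
        (GaussBound.prod hr s (fun i hi => hg i (by simp [hi])))).mono ?_
      exact le_of_eq (by ring)

/-- The bounds depend on the column only, and every term of the Leibniz expansion uses each column
exactly once. -/
theorem GaussBound.det {r : ℝ} (hr : 0 ≤ r) {ι : Type*} [Fintype ι] [DecidableEq ι]
    {A : Matrix ι ι K[X]} {b : ι → ℝ} (hb : ∀ i, 0 ≤ b i)
    (h : ∀ i j, GaussBound r (A i j) (b j)) :
    GaussBound r A.det (∏ i, b i) := by
  rw [Matrix.det_apply]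
  exact GaussBound.sum hr (Finset.prod_nonneg fun i _ => hb i) _ fun σ _ =>
    (GaussBound.prod hr _ fun i _ => h (σ i) i).units_smul _

theorem GaussBound.det_sub_det {r κ : ℝ} (hr : 0 ≤ r) (hκ : 0 ≤ κ) {ι : Type*} [Fintype ι]
    [DecidableEq ι] {A A' : Matrix ι ι K[X]} {b : ι → ℝ} (hb : ∀ i, 0 ≤ b i)
    (h : ∀ i j, GaussBound r (A i j) (b j)) (h' : ∀ i j, GaussBound r (A' i j) (b j))
    (hd : ∀ i j, GaussBound r (A i j - A' i j) (κ * b j)) :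
    GaussBound r (A.det - A'.det) (κ * ∏ i, b i) := by
  rw [Matrix.det_apply, Matrix.det_apply, ← Finset.sum_sub_distrib]
  refine GaussBound.sum hr (mul_nonneg hκ (Finset.prod_nonneg fun i _ => hb i)) _ fun σ _ => ?_
  rw [← smul_sub]
  exact (GaussBound.prod_sub_prod hr hκ _ (fun i _ => h (σ i) i) (fun i _ => h' (σ i) i)
    (fun i _ => hd (σ i) i)).units_smul _

theorem norm_eq_of_norm_sub_lt {x y : K} (h : ‖x - y‖ < ‖x‖) : ‖y‖ = ‖x‖ := by
  rw [norm_sub_rev] at h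
  have := IsUltrametricDist.norm_add_eq_max_of_norm_ne_norm (x := y - x) (y := x) h.ne
  rw [sub_add_cancel, max_eq_right h.le] at this
  exact this

/-- A coefficient that attains `M` dominates its perturbation and keeps its norm; one below `M`
stays below. -/
theorem IsPeak.perturb {r M δ : ℝ} (hr : 0 < r) {f g : K[X]} {k m : ℕ} (h : IsPeak r f M k m)
    (hd : GaussBound r (f - g) δ) (hδ : δ < M) : IsPeak r g M k m := by
  have heq : ∀ i, ‖f.coeff i‖ * r ^ i = M → ‖g.coeff i‖ * r ^ i = M := by
    intro i hi
    have h1 := (hd i).trans_lt (hδ.trans_eq hi.symm)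
    rw [coeff_sub] at h1
    rw [norm_eq_of_norm_sub_lt (lt_of_mul_lt_mul_right h1 (by positivity)), hi]
  have hlt : ∀ i, ‖f.coeff i‖ * r ^ i < M → ‖g.coeff i‖ * r ^ i < M := by
    intro i hi
    have h1 := (hd i).trans_lt hδ
    rw [coeff_sub] at h1
    calc ‖g.coeff i‖ * r ^ i ≤ max ‖f.coeff i‖ ‖f.coeff i - g.coeff i‖ * r ^ i := by
          gcongr
          simpa using norm_sub_le_max_norm (f.coeff i) (f.coeff i - g.coeff i)
      _ < M := by
          rw [max_mul_of_nonneg _ _ (by positivity)]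
          exact max_lt hi h1
  exact ⟨fun i => (h.bound i).lt_or_eq.elim (fun h => (hlt i h).le) (fun h => (heq i h).le),
    heq _ h.first, heq _ h.last, fun i hi => hlt i (h.lt_first i hi),
    fun i hi => hlt i (h.lt_last i hi)⟩

theorem norm_sub_eq_left {x y : K} (h : ‖y‖ < ‖x‖) : ‖x - y‖ = ‖x‖ := by
  apply norm_eq_of_norm_sub_lt; simpa using h

theorem norm_sub_eq_right {x y : K} (h : ‖x‖ < ‖y‖) : ‖x - y‖ = ‖y‖ := by
  rw [norm_sub_rev]; exact norm_sub_eq_left h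

/-- The effect on the peak of `f` of multiplication by a linear factor. -/
theorem IsPeak.linear_mul {r M : ℝ} (hr : 0 < r) {f : K[X]} {k m : ℕ} (h : IsPeak r f M k m)
    (hM : 0 < M) (x : K) :
    IsPeak r ((X - C x) * f) (max r ‖x‖ * M) (k + if ‖x‖ < r then 1 else 0)
      (m + if ‖x‖ ≤ r then 1 else 0) := by
  have hcz : ((X - C x) * f).coeff 0 = - (x * f.coeff 0) := by
    simp [sub_mul, mul_coeff_zero]
  have hcs : ∀ i, ((X - C x) * f).coeff (i + 1) = f.coeff i - x * f.coeff (i + 1) := by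
    intro i
    simp [sub_mul]
  have hx0 := norm_nonneg x
  have key : ∀ i, (‖f.coeff i‖ * r ^ i) * r = ‖f.coeff i‖ * r ^ (i + 1) := fun i => by ring
  have hle : ∀ i, ‖((X - C x) * f).coeff (i + 1)‖ * r ^ (i + 1) ≤
      max (r * (‖f.coeff i‖ * r ^ i)) (‖x‖ * (‖f.coeff (i + 1)‖ * r ^ (i + 1))) := by
    intro i
    rw [hcs]
    calc _ ≤ max ‖f.coeff i‖ ‖x * f.coeff (i + 1)‖ * r ^ (i + 1) := by
          gcongr
          exact norm_sub_le_max_norm _ _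
      _ = _ := by
          rw [max_mul_of_nonneg _ _ (by positivity), norm_mul]
          congr 1 <;> ring
  have heql : ∀ i, ‖x‖ * (‖f.coeff (i + 1)‖ * r ^ (i + 1)) < r * (‖f.coeff i‖ * r ^ i) →
      ‖((X - C x) * f).coeff (i + 1)‖ * r ^ (i + 1) = r * (‖f.coeff i‖ * r ^ i) := by
    intro i hi
    have : ‖x * f.coeff (i + 1)‖ < ‖f.coeff i‖ := by
      rw [norm_mul]
      refine lt_of_mul_lt_mul_right (a := r ^ (i + 1)) ?_ (by positivity)
      linarith [key i]
    rw [hcs, norm_sub_eq_left this]; ring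
  have heqr : ∀ i, r * (‖f.coeff i‖ * r ^ i) < ‖x‖ * (‖f.coeff (i + 1)‖ * r ^ (i + 1)) →
      ‖((X - C x) * f).coeff (i + 1)‖ * r ^ (i + 1) =
        ‖x‖ * (‖f.coeff (i + 1)‖ * r ^ (i + 1)) := by
    intro i hi
    have : ‖f.coeff i‖ < ‖x * f.coeff (i + 1)‖ := by
      rw [norm_mul]
      refine lt_of_mul_lt_mul_right (a := r ^ (i + 1)) ?_ (by positivity)
      linarith [key i]
    rw [hcs, norm_sub_eq_right this, norm_mul]; ring
  have hz : ‖((X - C x) * f).coeff 0‖ * r ^ 0 = ‖x‖ * (‖f.coeff 0‖ * r ^ 0) := by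
    rw [hcz, norm_neg, norm_mul]; ring
  have hrb : ∀ i, r * (‖f.coeff i‖ * r ^ i) ≤ r * M := fun i =>
    mul_le_mul_of_nonneg_left (h.bound i) hr.le
  have hxb : ∀ i, ‖x‖ * (‖f.coeff i‖ * r ^ i) ≤ ‖x‖ * M := fun i =>
    mul_le_mul_of_nonneg_left (h.bound i) hx0
  have hrf : ∀ i < k, r * (‖f.coeff i‖ * r ^ i) < r * M := fun i hi =>
    mul_lt_mul_of_pos_left (h.lt_first i hi) hr
  have hrl : ∀ i, m < i → r * (‖f.coeff i‖ * r ^ i) < r * M := fun i hi =>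
    mul_lt_mul_of_pos_left (h.lt_last i hi) hr
  have hf := h.first
  have hl := h.last
  rcases lt_trichotomy ‖x‖ r with hx | hx | hx
  -- The term from `X` dominates, so both ends shift by one.
  · have hxr : ‖x‖ * M < r * M := mul_lt_mul_of_pos_right hx hM
    rw [max_eq_left hx.le, if_pos hx, if_pos hx.le]
    refine ⟨?_, ?_, ?_, ?_, ?_⟩
    · rintro (_ | i)
      · rw [hz]; linarith [hxb 0]
      · exact (hle i).trans (max_le (hrb i) ((hxb _).trans hxr.le))
    · rw [heql k (by rw [hf]; linarith [hxb (k + 1)]), hf]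
    · rw [heql m (by rw [hl]; linarith [hxb (m + 1)]), hl]
    · rintro (_ | i) hi
      · rw [hz]; linarith [hxb 0]
      · exact (hle i).trans_lt (max_lt (hrf i (by omega)) ((hxb _).trans_lt hxr))
    · rintro (_ | i) hi
      · omega
      · exact (hle i).trans_lt (max_lt (hrl i (by omega)) ((hxb _).trans_lt hxr))
  -- Both terms have equal weight and could cancel, but not at the ends: at `k` the term from
  -- `f_{k-1}` is strictly smaller, and at `m + 1` the one from `f_{m+1}` is.
  · rw [hx, max_self, if_neg (lt_irrefl r), if_pos le_rfl, add_zero]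
    rw [hx] at hle heql heqr hz
    refine ⟨?_, ?_, ?_, ?_, ?_⟩
    · rintro (_ | i)
      · rw [hz]; exact hrb 0
      · exact (hle i).trans (max_le (hrb i) (hrb _))
    · rcases k with _ | k
      · rw [hz, hf]
      · rw [heqr k (by rw [hf]; exact hrf k (by omega)), hf]
    · rw [heql m (by rw [hl]; exact hrl _ (by omega)), hl]
    · rintro (_ | i) hi
      · rw [hz]; exact hrf 0 hi
      · exact (hle i).trans_lt (max_lt (hrf i (by omega)) (hrf _ hi))
    · rintro (_ | i) hi
      · omega
      · exact (hle i).trans_lt (max_lt (hrl i (by omega)) (hrl _ (by omega)))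
  -- The term from `x` dominates, so neither end moves.
  · have hxr : r * M < ‖x‖ * M := mul_lt_mul_of_pos_right hx hM
    have hx1 : 0 < ‖x‖ := hr.trans hx
    have heq : ∀ i, ‖f.coeff i‖ * r ^ i = M →
        ‖((X - C x) * f).coeff i‖ * r ^ i = ‖x‖ * M := by
      rintro (_ | i) hi
      · rw [hz, hi]
      · rw [heqr i (by rw [hi]; linarith [hrb i]), hi]
    have hlt : ∀ i, ‖f.coeff i‖ * r ^ i < M →
        ‖((X - C x) * f).coeff i‖ * r ^ i < ‖x‖ * M := by
      rintro (_ | i) hi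
      · rw [hz]; exact mul_lt_mul_of_pos_left hi hx1
      · exact (hle i).trans_lt (max_lt ((hrb i).trans_lt hxr) (mul_lt_mul_of_pos_left hi hx1))
    rw [max_eq_right hx.le, if_neg hx.le.not_gt, if_neg hx.not_ge, add_zero, add_zero]
    exact ⟨fun i => (h.bound i).lt_or_eq.elim (fun h => (hlt i h).le) fun h => (heq i h).le,
      heq _ hf, heq _ hl, fun i hi => hlt i (h.lt_first i hi),
      fun i hi => hlt i (h.lt_last i hi)⟩

/-- This plays the role of the Newton polygon. Each root contributes one linear factor, and
`IsPeak.linear_mul` shifts the two ends exactly as that root enters the two counts. -/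
theorem exists_isPeak {r : ℝ} (hr : 0 < r) (s : Multiset K) : ∃ M, 0 < M ∧
    IsPeak r (s.map fun x => X - C x).prod M (s.countP (‖·‖ < r)) (s.countP (‖·‖ ≤ r)) := by
  induction s using Multiset.induction_on with
  | empty => exact ⟨1, one_pos, by simpa using isPeak_one r⟩
  | cons x s ih =>
    obtain ⟨M, hM, h⟩ := ih
    refine ⟨max r ‖x‖ * M, mul_pos (lt_max_of_lt_left hr) hM, ?_⟩
    simp only [Multiset.map_cons, Multiset.prod_cons, Multiset.countP_cons]
    exact h.linear_mul hr hM x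

end Gauss
-- Characteristic polynomials through a Smith normal form
section Charpoly

variable {K : Type*} [NormedField K] {R : Type*} [CommRing R] {ι : Type*} [Fintype ι]
  [DecidableEq ι]

/-- The matrix `X • G - A` over the polynomial ring. -/
noncomputable def pencil (G A : Matrix ι ι R) : Matrix ι ι R[X] :=
  Matrix.of fun i j => X * C (G i j) - C (A i j)

/-- `U B V` is not a conjugate of `B`, so the identity matrix has to be carried along: `U (X - B) V
= X U V - U B V`. -/
theorem charpoly_eq_det_pencil (U V : Matrix.GeneralLinearGroup ι R) (B : Matrix ι ι R) :
    B.charpoly = C (((U.det⁻¹ * V.det⁻¹ : Rˣ)) : R) *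
      (pencil ((U : Matrix ι ι R) * (V : Matrix ι ι R))
        ((U : Matrix ι ι R) * B * (V : Matrix ι ι R))).det := by
  have h : pencil ((U : Matrix ι ι R) * (V : Matrix ι ι R))
        ((U : Matrix ι ι R) * B * (V : Matrix ι ι R)) =
      (U : Matrix ι ι R).map C * B.charmatrix * (V : Matrix ι ι R).map C := by
    have : pencil ((U : Matrix ι ι R) * (V : Matrix ι ι R))
        ((U : Matrix ι ι R) * B * (V : Matrix ι ι R)) =
        (X : R[X]) • ((U : Matrix ι ι R) * (V : Matrix ι ι R)).map C -
          ((U : Matrix ι ι R) * B * (V : Matrix ι ι R)).map C := by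
      ext1 i j
      simp only [pencil, Matrix.of_apply, Matrix.sub_apply, Matrix.smul_apply, Matrix.map_apply,
        smul_eq_mul]
    rw [this, Matrix.charmatrix, Matrix.map_mul, Matrix.map_mul, Matrix.map_mul, mul_sub, sub_mul]
    congr 1
    rw [Matrix.scalar_apply, ← Matrix.smul_one_eq_diagonal, Matrix.mul_smul, mul_one,
      Matrix.smul_mul]
  have hU : ((U : Matrix ι ι R).map (C : R →+* R[X])).det = C (U : Matrix ι ι R).det :=
    (RingHom.map_det C (U : Matrix ι ι R)).symm
  have hV : ((V : Matrix ι ι R).map (C : R →+* R[X])).det = C (V : Matrix ι ι R).det :=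
    (RingHom.map_det C (V : Matrix ι ι R)).symm
  have hu : (((U.det⁻¹ : Rˣ)) : R) * (U : Matrix ι ι R).det = 1 := U.det.inv_mul
  have hv : (((V.det⁻¹ : Rˣ)) : R) * (V : Matrix ι ι R).det = 1 := V.det.inv_mul
  rw [h, Matrix.det_mul, Matrix.det_mul, hU, hV, ← Matrix.charpoly]
  calc B.charpoly = C ((((U.det⁻¹ : Rˣ) : R) * (U : Matrix ι ι R).det) *
        (((V.det⁻¹ : Rˣ) : R) * (V : Matrix ι ι R).det)) * B.charpoly := by
        rw [hu, hv]; simp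
    _ = _ := by
      simp only [Units.val_mul, map_mul]
      ring

variable [IsUltrametricDist K] {φ : R →+* K}

omit [Fintype ι] [DecidableEq ι] in
theorem GaussBound.pencil_entry {r b : ℝ} (hr : 0 ≤ r) (hφ : ∀ x, ‖φ x‖ ≤ 1) (hrb : r ≤ b)
    (G A : Matrix ι ι R) (i j : ι) (hA : ‖φ (A i j)‖ ≤ b) :
    GaussBound r ((pencil G A i j).map φ) b := by
  have h : (pencil G A i j).map φ = X * C (φ (G i j)) + C (φ (-A i j)) := by
    simp [pencil, sub_eq_add_neg]
  rw [h]
  exact (gaussBound_X_mul_C hr (hφ _) hrb).add hr (gaussBound_C (by simpa using hA))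

/-- Gauss bounds for the characteristic polynomial of a matrix with Smith normal form `D`, and for
its variation under a perturbation divisible by `π`. -/
theorem GaussBound.charpoly {r κ : ℝ} (hr : 0 ≤ r) (hκ : 0 ≤ κ) (hφ : ∀ x, ‖φ x‖ ≤ 1)
    {b : ι → ℝ} (hrb : ∀ i, r ≤ b i) (U V : Matrix.GeneralLinearGroup ι R) {B : Matrix ι ι R}
    {D : ι → R} (hD : (U : Matrix ι ι R) * B * (V : Matrix ι ι R) = Matrix.diagonal D)
    (hDb : ∀ i, ‖φ (D i)‖ ≤ b i) :
    GaussBound r (B.charpoly.map φ) (∏ i, b i) ∧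
    ∀ (π : R) (W : Matrix ι ι R), ‖φ π‖ ≤ r → (∀ i, ‖φ π‖ ≤ κ * b i) →
      GaussBound r (B.charpoly.map φ - (B + π • W).charpoly.map φ) (κ * ∏ i, b i) := by
  have hb : ∀ i, 0 ≤ b i := fun i => hr.trans (hrb i)
  have hdiag : ∀ i j, ‖φ (Matrix.diagonal D i j)‖ ≤ b j := by
    intro i j
    rcases eq_or_ne i j with rfl | hij
    · simpa using hDb i
    · simpa [hij] using hb j
  have hdet : ∀ G A : Matrix ι ι R, (pencil G A).det.map φ =
      ((pencil G A).map (Polynomial.map φ)).det := fun G A =>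
    RingHom.map_det (mapRingHom φ) (pencil G A)
  have hB := fun i j => GaussBound.pencil_entry hr hφ (hrb j)
    ((U : Matrix ι ι R) * (V : Matrix ι ι R)) (Matrix.diagonal D) i j (hdiag i j)
  have hmul : ∀ {f : K[X]} {M : ℝ} (x : R), GaussBound r f M → GaussBound r (C (φ x) * f) M :=
    fun x hf => by simpa using (gaussBound_C (r := r) (hφ x)).mul hr hf
  refine ⟨?_, fun π W hπr hπ => ?_⟩
  · rw [charpoly_eq_det_pencil U V, hD, Polynomial.map_mul, map_C, hdet]
    exact hmul _ (GaussBound.det hr hb hB)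
  · have hD' : (U : Matrix ι ι R) * (B + π • W) * (V : Matrix ι ι R) =
        Matrix.diagonal D + π • ((U : Matrix ι ι R) * W * (V : Matrix ι ι R)) := by
      rw [mul_add, add_mul, hD, Matrix.mul_smul, Matrix.smul_mul]
    have hW : ∀ W' : Matrix ι ι R, ∀ i j, ‖φ ((π • W') i j)‖ ≤ ‖φ π‖ := by
      intro W' i j
      rw [Matrix.smul_apply, smul_eq_mul, map_mul, norm_mul]
      exact mul_le_of_le_one_right (norm_nonneg _) (hφ _)
    rw [charpoly_eq_det_pencil U V B, charpoly_eq_det_pencil U V (B + π • W), hD, hD',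
      Polynomial.map_mul, Polynomial.map_mul, map_C, hdet, hdet, ← mul_sub]
    refine hmul _ (GaussBound.det_sub_det hr hκ hb hB (fun i j => ?_) (fun i j => ?_))
    · refine GaussBound.pencil_entry hr hφ (hrb j) _ _ i j ?_
      rw [Matrix.add_apply, map_add]
      exact (IsUltrametricDist.norm_add_le_max _ _).trans
        (max_le (hdiag i j) ((hW _ i j).trans (hπr.trans (hrb j))))
    · have : ∀ G A A' : Matrix ι ι R, (pencil G A i j).map φ - (pencil G (A + A') i j).map φ =
          C (φ (A' i j)) := by
        intro G A A'
        simp [pencil]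
      rw [Matrix.map_apply, Matrix.map_apply, this]
      exact gaussBound_C ((hW _ i j).trans (hπ j))

end Charpoly
-- The constants and the inequality of exponents
section Numerics

/-- The sum of the first `d k` terms of the sequence `⌊i / d⌋`. -/
theorem sum_range_mul_div {d : ℕ} (hd : 0 < d) (k : ℕ) :
    ∑ i ∈ Finset.range (d * k), ((i / d : ℕ) : ℝ) = d * (k * (k - 1) / 2) := by
  induction k with
  | zero => simp
  | succ k ih =>
    have h : ∀ j ∈ Finset.range d, (((d * k + j) / d : ℕ) : ℝ) = k := by
      intro j hj
      rw [Nat.mul_add_div hd, Nat.div_eq_of_lt (Finset.mem_range.1 hj), add_zero]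
    rw [mul_add, mul_one, Finset.sum_range_add, ih, Finset.sum_congr rfl h]
    simp only [Finset.sum_const, Finset.card_range, nsmul_eq_mul]
    push_cast
    ring

/-- The terms of the set whose infimum is `constC₂`, at `l = d₀ k + 1`. -/
theorem constC₂_le {p n d₀ ε₀ k : ℕ} (hd₀ : 0 < d₀) (hk : k ≤ p ^ n) (hε : ε₀ ≤ d₀ * k) :
    constC₂ p n d₀ ε₀ ≤
      (2 * (p : ℝ) ^ n + d₀ * (k * (k - 1))) / (2 * ((d₀ * k + 1 : ℝ) - ε₀)) := by
  refine csInf_le ⟨0, ?_⟩ ⟨d₀ * k + 1, by omega, ?_, ?_⟩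
  · rintro x ⟨l, hl, -, rfl⟩
    have h1 : (ε₀ : ℝ) < l := by exact_mod_cast hl
    have h2 : (0 : ℝ) ≤ (qIdx d₀ l : ℝ) * ((qIdx d₀ l : ℝ) - 1) := by
      rcases (qIdx d₀ l).eq_zero_or_pos with h | h
      · simp [h]
      · have : (1 : ℝ) ≤ qIdx d₀ l := by exact_mod_cast h
        nlinarith
    refine div_nonneg ?_ (by linarith)
    rw [mul_assoc (d₀ : ℝ)]
    positivity
  · rw [add_comm]; gcongr
  · rcases k.eq_zero_or_pos with rfl | hk0
    · simp [qIdx]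
    · obtain ⟨j, rfl⟩ : ∃ j, k = j + 1 := ⟨k - 1, by omega⟩
      -- For `l = d₀ k + 1` with `k ≥ 1`, `q_l = k - 1` and `r_l = d₀ - 1`, so the numerator
      -- collapses to `2 p ^ n + d₀ k (k - 1)`.
      have hne : d₀ * (j + 1) + 1 ≠ 1 := by
        have := Nat.mul_pos hd₀ hk0
        omega
      have hq : qIdx d₀ (d₀ * (j + 1) + 1) = j := by
        rw [qIdx, if_neg hne,
          show d₀ * (j + 1) + 1 - 2 = d₀ * j + (d₀ - 1) by rw [mul_add]; omega,
          Nat.mul_add_div hd₀, Nat.div_eq_of_lt (by omega), add_zero]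
      have hr : rIdx d₀ (d₀ * (j + 1) + 1) = d₀ - 1 := by
        rw [rIdx, if_neg hne, hq, mul_add]; omega
      rw [hq, hr, Nat.cast_sub hd₀]
      push_cast
      congr 1
      ring

/-- An infimum of positive numbers needs a uniform lower bound: each numerator is at least `2 p ^ n`
and each denominator at most `2 (1 + d₀ p ^ n)`. -/
theorem constC₂_pos {p n d₀ ε₀ : ℕ} (hp : 0 < p) (hε : ε₀ ≤ d₀ * p ^ n) :
    0 < constC₂ p n d₀ ε₀ := by
  have hlow : ∀ x ∈ {x : ℝ | ∃ l : ℕ, ε₀ < l ∧ l ≤ 1 + d₀ * p ^ n ∧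
    x = (2 * (p : ℝ) ^ n + d₀ * (qIdx d₀ l : ℝ) * ((qIdx d₀ l : ℝ) - 1)
      + 2 * (qIdx d₀ l : ℝ) * ((rIdx d₀ l : ℝ) + 1)) / (2 * ((l : ℝ) - ε₀))},
      (p : ℝ) ^ n / (1 + d₀ * p ^ n) ≤ x := by
    rintro x ⟨l, hl, hl', rfl⟩
    have h1 : (ε₀ : ℝ) < l := by exact_mod_cast hl
    have h1' : (l : ℝ) ≤ 1 + d₀ * (p : ℝ) ^ n := by exact_mod_cast hl'
    have h2 : (0 : ℝ) ≤ (qIdx d₀ l : ℝ) * ((qIdx d₀ l : ℝ) - 1) := by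
      rcases (qIdx d₀ l).eq_zero_or_pos with h | h
      · simp [h]
      · have : (1 : ℝ) ≤ qIdx d₀ l := by exact_mod_cast h
        nlinarith
    have h3 : (0 : ℝ) ≤ d₀ * (qIdx d₀ l : ℝ) * ((qIdx d₀ l : ℝ) - 1) := by
      rw [mul_assoc (d₀ : ℝ)]; positivity
    have h4 : (0 : ℝ) ≤ 2 * (qIdx d₀ l : ℝ) * ((rIdx d₀ l : ℝ) + 1) := by positivity
    have h5 : (0 : ℝ) ≤ ε₀ := by positivity
    calc (p : ℝ) ^ n / (1 + d₀ * p ^ n) = 2 * (p : ℝ) ^ n / (2 * (1 + d₀ * p ^ n)) := by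
          rw [mul_div_mul_left _ _ two_ne_zero]
      _ ≤ _ := by
          apply div_le_div₀ <;> first | positivity | linarith
  refine lt_of_lt_of_le ?_ (le_csInf ⟨_, 1 + d₀ * p ^ n, by omega, le_rfl, rfl⟩ hlow)
  positivity

theorem constC₁_mem_Ioo {p n d₀ ε₀ : ℕ} (hpn : 2 ≤ p ^ n) (hd₀ : 0 < d₀) (hε : ε₀ ≤ d₀) :
    constC₁ p n d₀ ε₀ ∈ Set.Ioo (0 : ℝ) ((p : ℝ) ^ n) := by
  have h1 : (2 : ℝ) ≤ (p : ℝ) ^ n := by exact_mod_cast hpn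
  have h2 : (ε₀ : ℝ) ≤ d₀ := by exact_mod_cast hε
  have h3 : (0 : ℝ) < d₀ := by exact_mod_cast hd₀
  have h4 : (d₀ : ℝ) * 2 ≤ d₀ * (p : ℝ) ^ n := by gcongr
  have hden : (0 : ℝ) < 4 + 2 * d₀ * (p : ℝ) ^ n - 2 * ε₀ := by nlinarith
  have hnum : (0 : ℝ) < 4 + d₀ * (p : ℝ) ^ n - d₀ := by nlinarith
  refine ⟨mul_pos (by linarith) (div_pos hnum hden), ?_⟩
  refine mul_lt_of_lt_one_right (by linarith) ((div_lt_one hden).2 ?_)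
  nlinarith

theorem constC₂_lt {p n d₀ ε₀ : ℕ} (hpn : 2 ≤ p ^ n) (hd₀ : 0 < d₀) (hε : ε₀ ≤ d₀) :
    constC₂ p n d₀ ε₀ < (p : ℝ) ^ n := by
  have h1 : (2 : ℝ) ≤ (p : ℝ) ^ n := by exact_mod_cast hpn
  have h2 : (ε₀ : ℝ) ≤ d₀ := by exact_mod_cast hε
  have h3 : (0 : ℝ) < d₀ := by exact_mod_cast hd₀
  have h4 : (d₀ : ℝ) * 2 ≤ d₀ * (p : ℝ) ^ n := by gcongr
  -- The largest admissible `l`, namely `1 + d₀ p ^ n`, already gives a value below `p ^ n`, because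
  -- `2 ε₀ < d₀ p ^ n + d₀`.
  refine (constC₂_le hd₀ le_rfl (hε.trans (Nat.le_mul_of_pos_right _ (by omega)))).trans_lt ?_
  push_cast
  rw [div_lt_iff₀ (by linarith)]
  have : (0 : ℝ) < (p : ℝ) ^ n * (d₀ * (p : ℝ) ^ n + d₀ - 2 * ε₀) :=
    mul_pos (by linarith) (by linarith)
  nlinarith

/-- The inequality between exponents that separates the variation of the characteristic polynomial
from its peak. -/
theorem exponent_lt {p n d₀ ε₀ L : ℕ} (hd₀ : 0 < d₀) {a : ℝ} (ha : 0 ≤ a) (hp : a ≤ (p : ℝ) ^ n)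
    (hp0 : 0 < p) (haC : a < constC₂ p n d₀ ε₀) :
    a * (L - ε₀) < (p : ℝ) ^ n - a + ∑ i : Fin L, min a (((i : ℕ) / d₀ : ℕ) : ℝ) := by
  -- The deficit `a - min(a, ⌊i/d₀⌋)` vanishes for `i ≥ d₀ ⌈a⌉`, which makes the bound independent
  -- of `L`.
  have hsum : ∑ i : Fin L, (a - min a (((i : ℕ) / d₀ : ℕ) : ℝ)) ≤
      ∑ i ∈ Finset.range (d₀ * ⌈a⌉₊), (a - ((i / d₀ : ℕ) : ℝ)) := by
    rw [Fin.sum_univ_eq_sum_range (fun i => a - min a ((i / d₀ : ℕ) : ℝ)) L]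
    have hlt : ∀ i, i < d₀ * ⌈a⌉₊ ↔ ((i / d₀ : ℕ) : ℝ) < a := by
      intro i
      rw [← Nat.lt_ceil, Nat.div_lt_iff_lt_mul hd₀, mul_comm]
    calc ∑ i ∈ Finset.range L, (a - min a ((i / d₀ : ℕ) : ℝ))
        = ∑ i ∈ (Finset.range L).filter (· < d₀ * ⌈a⌉₊), (a - min a ((i / d₀ : ℕ) : ℝ)) := by
          refine (Finset.sum_filter_of_ne fun i _ hi => ?_).symm
          rw [hlt]
          by_contra hcon
          exact hi (by rw [min_eq_left (not_lt.1 hcon), sub_self])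
      _ ≤ ∑ i ∈ Finset.range (d₀ * ⌈a⌉₊), (a - min a ((i / d₀ : ℕ) : ℝ)) := by
          refine Finset.sum_le_sum_of_subset_of_nonneg (fun i hi => ?_) fun i _ _ => ?_
          · exact Finset.mem_range.2 (Finset.mem_filter.1 hi).2
          · exact sub_nonneg.2 (min_le_left _ _)
      _ = _ := Finset.sum_congr rfl fun i hi => by
          rw [min_eq_right ((hlt i).1 (Finset.mem_range.1 hi)).le]
  rw [Finset.sum_sub_distrib, Finset.sum_sub_distrib, sum_range_mul_div hd₀] at hsum
  simp only [Finset.sum_const, Finset.card_univ, Fintype.card_fin, Finset.card_range,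
    nsmul_eq_mul] at hsum
  -- This makes `l = d₀ ⌈a⌉ + 1` admissible in the definition of `C₂`.
  have hk : ⌈a⌉₊ ≤ p ^ n := Nat.ceil_le.2 (by exact_mod_cast hp)
  generalize ⌈a⌉₊ = k at *
  have hm : (0 : ℝ) < (p : ℝ) ^ n := by positivity
  push_cast at hsum
  have hkk : (0 : ℝ) ≤ (k : ℝ) * (k - 1) := by
    rcases k.eq_zero_or_pos with h | h
    · simp [h]
    · have : (1 : ℝ) ≤ k := by exact_mod_cast h
      nlinarith
  have hdk : (0 : ℝ) ≤ d₀ * ((k : ℝ) * (k - 1)) := by positivity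
  -- What is needed is `a (d₀ k + 1 - ε₀) < p ^ n + d₀ k (k - 1) / 2`. If `ε₀ > d₀ k`, the left side
  -- is nonpositive.
  rcases le_or_gt ε₀ (d₀ * k) with hε | hε
  · have h1 := haC.trans_le (constC₂_le hd₀ hk hε)
    have h2 : (ε₀ : ℝ) ≤ d₀ * k := by exact_mod_cast hε
    rw [lt_div_iff₀ (by linarith)] at h1
    nlinarith
  · have h2 : (d₀ * k + 1 : ℝ) ≤ ε₀ := by exact_mod_cast hε
    nlinarith [mul_le_mul_of_nonneg_left h2 ha]

end Numerics
-- Eigenvalues in `ℂ_℘` and peaks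
section Field

variable {F : Type*} [Field F] {P : F[X]} [Fact (Irreducible P)]

theorem wp_ne_zero : wp P ≠ 0 := by
  have hP : P ≠ 0 := (Fact.out : Irreducible P).ne_zero
  rw [wp, IsScalarTower.algebraMap_apply F[X] (RatFunc F) (LocalFld P)]
  simpa using hP

theorem norm_wp_lt_one : ‖wp P‖ < 1 := by
  rw [Valued.toNormedField.norm_lt_one_iff, wp,
    IsDedekindDomain.HeightOneSpectrum.valuedAdicCompletion_eq_valuation,
    IsDedekindDomain.HeightOneSpectrum.valuation_lt_one_iff_mem]
  exact Ideal.mem_span_singleton_self P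

theorem norm_wp_pos : 0 < ‖wp P‖ := norm_pos_iff.2 wp_ne_zero

theorem valWp_eq_coe_iff (x : Cwp P) (a : ℝ) : valWp x = (a : WithTop ℝ) ↔ ‖x‖ = ‖wp P‖ ^ a := by
  by_cases hx : x = 0
  · simpa [valWp, hx] using (Real.rpow_pos_of_pos norm_wp_pos a).ne
  · rw [valWp, if_neg hx, WithTop.coe_inj,
      Real.logb_eq_iff_rpow_eq norm_wp_pos norm_wp_lt_one.ne (norm_pos_iff.2 hx), eq_comm]

theorem norm_le_of_le_valWp {x : Cwp P} {a : ℝ} (h : (a : WithTop ℝ) ≤ valWp x) :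
    ‖x‖ ≤ ‖wp P‖ ^ a := by
  by_cases hx : x = 0
  · simpa [hx] using (Real.rpow_pos_of_pos norm_wp_pos a).le
  · rw [valWp, if_neg hx, WithTop.coe_le_coe] at h
    calc ‖x‖ = ‖wp P‖ ^ Real.logb ‖wp P‖ ‖x‖ :=
          (Real.rpow_logb norm_wp_pos norm_wp_lt_one.ne (norm_pos_iff.2 hx)).symm
      _ ≤ _ := Real.rpow_le_rpow_of_exponent_ge norm_wp_pos norm_wp_lt_one.le h

/-- The minimal polynomial already splits in the algebraic closure, so completion adds no new
algebraic elements. Hence matrices over `𝒪_E` have split characteristic polynomials without appeal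
to the algebraic closedness of `ℂ_℘`. -/
theorem mem_range_algCl {x : Cwp P} (hx : IsAlgebraic (LocalFld P) x) :
    x ∈ (UniformSpace.Completion.coeRingHom : AlgCl P →+* Cwp P).range := by
  have hi : IsIntegral (LocalFld P) x := hx.isIntegral
  have hs := IsAlgClosed.splits ((minpoly (LocalFld P) x).map (algebraMap _ (AlgCl P)))
  have hcomp : (UniformSpace.Completion.coeRingHom : AlgCl P →+* Cwp P).comp
      (algebraMap (LocalFld P) (AlgCl P)) = algebraMap (LocalFld P) (Cwp P) := rfl
  have h0 : aeval x (minpoly (LocalFld P) x) = 0 := minpoly.aeval _ _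
  rw [aeval_def, ← hcomp, ← eval₂_map] at h0
  exact hs.mem_range_of_isRoot (((minpoly.monic hi).map _).ne_zero)
    (by rwa [IsRoot, eval_map])

variable {E : IntermediateField (LocalFld P) (Cwp P)} {L : ℕ}

/-- The inclusion of `𝒪_E` into `ℂ_℘`. -/
noncomputable def inclC (E : IntermediateField (LocalFld P) (Cwp P)) : ringInt E →+* Cwp P :=
  (algebraMap E (Cwp P)).comp (ringInt E).subtype

theorem norm_inclC_le_one (x : ringInt E) : ‖inclC E x‖ ≤ 1 := by
  have := x.2
  exact this

theorem splits_charpoly_inclC [FiniteDimensional (LocalFld P) E]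
    (B : Matrix (Fin L) (Fin L) (ringInt E)) : (B.map (inclC E)).charpoly.Splits := by
  have h : ∀ i j, ∃ y : AlgCl P, UniformSpace.Completion.coeRingHom y = inclC E (B i j) := by
    intro i j
    apply mem_range_algCl
    exact (Algebra.IsAlgebraic.isAlgebraic (R := LocalFld P) (B i j : E)).algebraMap
  choose A hA using h
  have hAB : B.map (inclC E) =
      (Matrix.of A).map (UniformSpace.Completion.coeRingHom : AlgCl P →+* Cwp P) := by
    ext1 i j
    exact (hA i j).symm
  rw [hAB, Matrix.charpoly_map]
  exact (IsAlgClosed.splits _).map _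

theorem slopeMult_eq (B : Matrix (Fin L) (Fin L) (ringInt E)) (a : ℚ) :
    slopeMult B a = (B.charpoly.map (inclC E)).roots.countP
      (fun x => ‖x‖ = ‖wp P‖ ^ (a : ℝ)) := by
  rw [← Matrix.charpoly_map]
  exact Multiset.countP_congr rfl fun x _ => by rw [valWp_eq_coe_iff]

theorem countP_norm_le {K : Type*} [NormedField K] (s : Multiset K) (r : ℝ) :
    s.countP (‖·‖ ≤ r) = s.countP (‖·‖ < r) + s.countP (‖·‖ = r) := by
  induction s using Multiset.induction_on with
  | empty => simp
  | cons x s ih =>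
    simp only [Multiset.countP_cons, ih]
    rcases lt_trichotomy ‖x‖ r with h | h | h
    · rw [if_pos h.le, if_pos h, if_neg h.ne]; ring
    · rw [if_pos h.le, if_neg h.not_lt, if_pos h]; ring
    · rw [if_neg h.not_ge, if_neg h.not_gt, if_neg h.ne']; ring

/-- The peak of the characteristic polynomial of `B` for the weight `‖℘‖ ^ a`. -/
theorem exists_isPeak_charpoly [FiniteDimensional (LocalFld P) E]
    (B : Matrix (Fin L) (Fin L) (ringInt E)) (a : ℚ) : ∃ M k,
    IsPeak (‖wp P‖ ^ (a : ℝ)) (B.charpoly.map (inclC E)) M k (k + slopeMult B a) := by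
  have hs := splits_charpoly_inclC B
  rw [Matrix.charpoly_map] at hs
  obtain ⟨M, -, h⟩ := exists_isPeak (Real.rpow_pos_of_pos (norm_wp_pos (P := P)) (a : ℝ))
    (B.charpoly.map (inclC E)).roots
  refine ⟨M, (B.charpoly.map (inclC E)).roots.countP (‖·‖ < ‖wp P‖ ^ (a : ℝ)), ?_⟩
  rw [countP_norm_le, ← slopeMult_eq] at h
  rwa [← hs.eq_prod_roots_of_monic (B.charpoly_monic.map _)] at h

theorem norm_coeff_charpoly_le_one (B : Matrix (Fin L) (Fin L) (ringInt E)) (i : ℕ) :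
    ‖(B.charpoly.map (inclC E)).coeff i‖ ≤ 1 := by
  rw [coeff_map]; exact norm_inclC_le_one _

/-- The number `ε` of unit eigenvalues gives a unit coefficient in degree `L - ε`. -/
theorem exists_norm_coeff_eq_one [FiniteDimensional (LocalFld P) E]
    (B : Matrix (Fin L) (Fin L) (ringInt E)) : ∃ k, k + slopeMult B 0 = L ∧
    ‖(B.charpoly.map (inclC E)).coeff k‖ = 1 := by
  obtain ⟨M, k, h⟩ := exists_isPeak_charpoly B 0
  simp only [Rat.cast_zero, Real.rpow_zero] at h
  have hmon : (B.charpoly.map (inclC E)).Monic := B.charpoly_monic.map _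
  have hdeg : (B.charpoly.map (inclC E)).natDegree = L := by
    rw [B.charpoly_monic.natDegree_map, B.charpoly_natDegree_eq_dim, Fintype.card_fin]
  have hL : ‖(B.charpoly.map (inclC E)).coeff L‖ * 1 ^ L = 1 := by
    rw [show (B.charpoly.map (inclC E)).coeff L = 1 by
      simpa only [hdeg] using hmon.coeff_natDegree]
    simp
  -- At weight `1` all coefficients are integral and the leading one is `1`. So the peak has height
  -- `1` and ends at `L`, and it begins at `L - ε`.
  have hM : M = 1 := le_antisymm
    (by rw [← h.first]; simpa using norm_coeff_charpoly_le_one B k) (hL ▸ h.bound L)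
  subst hM
  refine ⟨k, le_antisymm ?_ ?_, by simpa using h.first⟩
  · by_contra hcon
    have := h.last
    rw [coeff_eq_zero_of_natDegree_lt (by omega)] at this
    simp at this
  · by_contra hcon
    exact (h.lt_last L (by omega)).ne hL

end Field
-- Elementary divisors and slopes
section Slopes

variable {F : Type*} [Field F] {P : F[X]} [Fact (Irreducible P)]
  {E : IntermediateField (LocalFld P) (Cwp P)} {L d₀ : ℕ}

/-- Gauss bounds with weight `‖℘‖ ^ a` for the characteristic polynomial of `B` and for its
variation, in terms of lower bounds of the elementary divisors. -/
theorem gaussBound_charpoly_of_elementaryDivisors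
    {B : Matrix (Fin L) (Fin L) (ringInt E)} {s : Fin L → WithTop ℝ}
    (hs : IsElementaryDivisors B s) (hsd : ∀ i : Fin L, (((i : ℕ) / d₀ : ℕ) : WithTop ℝ) ≤ s i)
    (a : ℝ) :
    GaussBound (‖wp P‖ ^ a) (B.charpoly.map (inclC E))
      (‖wp P‖ ^ ∑ i : Fin L, min a (((i : ℕ) / d₀ : ℕ) : ℝ)) ∧
    ∀ (m : ℕ) (B' : Matrix (Fin L) (Fin L) (ringInt E)), a ≤ m → CongrModPow m B B' →
      GaussBound (‖wp P‖ ^ a) (B.charpoly.map (inclC E) - B'.charpoly.map (inclC E))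
        (‖wp P‖ ^ (m - a + ∑ i : Fin L, min a (((i : ℕ) / d₀ : ℕ) : ℝ))) := by
  obtain ⟨-, U, V, D, hD, hsD⟩ := hs
  have hρ := norm_wp_pos (P := P)
  have hρ1 := (norm_wp_lt_one (P := P)).le
  have hanti : ∀ {x y : ℝ}, x ≤ y → ‖wp P‖ ^ y ≤ ‖wp P‖ ^ x := fun h =>
    Real.rpow_le_rpow_of_exponent_ge hρ hρ1 h
  have hra : ∀ i : Fin L, ‖wp P‖ ^ a ≤ ‖wp P‖ ^ min a (((i : ℕ) / d₀ : ℕ) : ℝ) := fun i =>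
    hanti (min_le_left _ _)
  have hDb : ∀ i : Fin L, ‖inclC E (D i)‖ ≤ ‖wp P‖ ^ min a (((i : ℕ) / d₀ : ℕ) : ℝ) := by
    intro i
    refine (norm_le_of_le_valWp (a := (((i : ℕ) / d₀ : ℕ) : ℝ)) ?_).trans (hanti (min_le_right _ _))
    exact (hsd i).trans (hsD i).le
  have hprod : ∏ i : Fin L, ‖wp P‖ ^ min a (((i : ℕ) / d₀ : ℕ) : ℝ) =
      ‖wp P‖ ^ ∑ i : Fin L, min a (((i : ℕ) / d₀ : ℕ) : ℝ) :=
    (Real.rpow_sum_of_pos hρ _ _).symm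
  refine ⟨?_, fun m B' ham hBB' => ?_⟩
  · rw [← hprod]
    exact (GaussBound.charpoly (Real.rpow_nonneg hρ.le a) zero_le_one norm_inclC_le_one hra U V
      hD hDb).1
  · obtain ⟨W, hW⟩ := hBB'
    have hwpC : ‖((algebraMap (LocalFld P) E (wp P) ^ m : E) : Cwp P)‖ = ‖wp P‖ ^ (m : ℝ) := by
      rw [Real.rpow_natCast, ← norm_algebraMap' (Cwp P) (wp P), ← norm_pow]
      rfl
    let π : ringInt E := ⟨algebraMap (LocalFld P) E (wp P) ^ m, by
      change ‖((algebraMap (LocalFld P) E (wp P) ^ m : E) : Cwp P)‖ ≤ 1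
      rw [hwpC, Real.rpow_natCast]
      exact pow_le_one₀ hρ.le hρ1⟩
    have hπ : ‖inclC E π‖ = ‖wp P‖ ^ (m : ℝ) := hwpC
    have hB' : B' = B + π • W := by
      ext i j
      have := hW i j
      rw [sub_eq_iff_eq_add'] at this
      exact congrArg (Subtype.val : E → Cwp P) this
    -- The relative error is `κ = ‖℘‖ ^ (m - a)`, which suffices because every column bound is at
    -- least `‖℘‖ ^ a`.
    rw [hB', Real.rpow_add hρ, ← hprod]
    refine (GaussBound.charpoly (Real.rpow_nonneg hρ.le a) (Real.rpow_nonneg hρ.le _)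
      norm_inclC_le_one hra U V hD hDb).2 π W (hπ.le.trans (hanti ham)) fun i => ?_
    rw [hπ, ← Real.rpow_add hρ]
    exact hanti (by linarith [min_le_left a (((i : ℕ) / d₀ : ℕ) : ℝ)])

/-- At most `d₀` eigenvalues are units. -/
theorem slopeMult_zero_le [FiniteDimensional (LocalFld P) E] (hd₀ : 0 < d₀)
    {B : Matrix (Fin L) (Fin L) (ringInt E)} {s : Fin L → WithTop ℝ}
    (hs : IsElementaryDivisors B s) (hsd : ∀ i : Fin L, (((i : ℕ) / d₀ : ℕ) : WithTop ℝ) ≤ s i) :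
    slopeMult B 0 ≤ d₀ := by
  obtain ⟨k, hk, hk1⟩ := exists_norm_coeff_eq_one B
  -- At weight `‖℘‖`, the unit coefficient in degree `L - ε` forces `∑ min(1, ⌊i/d₀⌋) ≤ L - ε`; only
  -- the indices `i < d₀` fall short of `1`.
  have h := (gaussBound_charpoly_of_elementaryDivisors hs hsd 1).1 k
  rw [hk1, one_mul, ← Real.rpow_natCast, ← Real.rpow_mul norm_wp_pos.le,
    Real.rpow_le_rpow_left_iff_of_base_lt_one norm_wp_pos norm_wp_lt_one, one_mul] at h
  have hsum : ∑ i : Fin L, (1 - min 1 (((i : ℕ) / d₀ : ℕ) : ℝ)) ≤ d₀ := by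
    rw [Fin.sum_univ_eq_sum_range (fun i => 1 - min 1 ((i / d₀ : ℕ) : ℝ)) L]
    calc ∑ i ∈ Finset.range L, (1 - min 1 ((i / d₀ : ℕ) : ℝ))
        = ∑ i ∈ (Finset.range L).filter (· < d₀), (1 - min 1 ((i / d₀ : ℕ) : ℝ)) := by
          refine (Finset.sum_filter_of_ne fun i _ hi => ?_).symm
          by_contra hcon
          have : (1 : ℝ) ≤ ((i / d₀ : ℕ) : ℝ) := by
            exact_mod_cast (Nat.one_le_div_iff hd₀).2 (not_lt.1 hcon)
          exact hi (by rw [min_eq_left this, sub_self])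
      _ ≤ ∑ i ∈ Finset.range d₀, (1 - min 1 ((i / d₀ : ℕ) : ℝ)) := by
          refine Finset.sum_le_sum_of_subset_of_nonneg (fun i hi => ?_) fun i _ _ => ?_
          · exact Finset.mem_range.2 (Finset.mem_filter.1 hi).2
          · exact sub_nonneg.2 (min_le_left _ _)
      _ ≤ ∑ i ∈ Finset.range d₀, (1 : ℝ) := Finset.sum_le_sum fun i _ => by
          have : (0 : ℝ) ≤ min 1 ((i / d₀ : ℕ) : ℝ) := by positivity
          linarith
      _ = d₀ := by simp
  rw [Finset.sum_sub_distrib] at hsum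
  simp only [Finset.sum_const, Finset.card_univ, Fintype.card_fin, nsmul_eq_mul, mul_one] at hsum
  have hk' : (k : ℝ) + slopeMult B 0 = L := by exact_mod_cast hk
  have : (slopeMult B 0 : ℝ) ≤ d₀ := by linarith
  exact_mod_cast this

end Slopes
end DrinfeldSlopes

/-! ### Local constancy of the slope multiplicities -/

open DrinfeldSlopes in
theorem proposition3p9 {F : Type*} [Field F] [Finite F] (p : ℕ) [Fact p.Prime] [CharP F p]
    (P : F[X]) [Fact (Irreducible P)]
    (E : IntermediateField (DrinfeldSlopes.LocalFld P) (DrinfeldSlopes.Cwp P))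
    [FiniteDimensional (DrinfeldSlopes.LocalFld P) E]
    (d₀ n L : ℕ) (hd₀ : 0 < d₀) (hn : 0 < n) (hL : 0 < L)
    (B : Matrix (Fin L) (Fin L) (DrinfeldSlopes.ringInt E))
    (s : Fin L → WithTop ℝ) (hs : DrinfeldSlopes.IsElementaryDivisors B s)
    (hsd : ∀ i : Fin L, (((i : ℕ) / d₀ : ℕ) : WithTop ℝ) ≤ s i)
    (ε₀ : ℕ) (hε₀ : ε₀ = DrinfeldSlopes.slopeMult B 0) :
    DrinfeldSlopes.constC₁ p n d₀ ε₀ ∈ Set.Ioo (0 : ℝ) ((p : ℝ) ^ n) ∧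
    DrinfeldSlopes.constC p n d₀ ε₀ ∈ Set.Ioo (0 : ℝ) ((p : ℝ) ^ n) ∧
    ∀ B' : Matrix (Fin L) (Fin L) (DrinfeldSlopes.ringInt E),
      DrinfeldSlopes.CongrModPow (p ^ n) B B' →
      ∀ a : ℚ, 0 ≤ a → (a : ℝ) < DrinfeldSlopes.constC p n d₀ ε₀ →
        DrinfeldSlopes.slopeMult B a = DrinfeldSlopes.slopeMult B' a := by
  have hp0 : 0 < p := (Fact.out : p.Prime).pos
  have hpn : 2 ≤ p ^ n := (Fact.out : p.Prime).two_le.trans (Nat.le_self_pow hn.ne' p)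
  have hε : ε₀ ≤ d₀ := hε₀ ▸ slopeMult_zero_le hd₀ hs hsd
  have hC₁ := constC₁_mem_Ioo hpn hd₀ hε
  have hC₂ := constC₂_lt hpn hd₀ hε
  have hC₂' : 0 < constC₂ p n d₀ ε₀ :=
    constC₂_pos hp0 (hε.trans (Nat.le_mul_of_pos_right _ (by omega)))
  refine ⟨hC₁, ⟨lt_min hC₁.1 hC₂', (min_le_right _ _).trans_lt hC₂⟩, fun B' hBB' a ha haC => ?_⟩
  have haC₂ := haC.trans_le (min_le_right _ _)
  have ha0 : (0 : ℝ) ≤ a := by exact_mod_cast ha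
  have hap : (a : ℝ) ≤ (p : ℝ) ^ n := (haC₂.trans hC₂).le
  obtain ⟨k, hk, hk1⟩ := exists_norm_coeff_eq_one B
  obtain ⟨M, j, hB⟩ := exists_isPeak_charpoly B a
  obtain ⟨M', j', hB'⟩ := exists_isPeak_charpoly B' a
  have hd := (gaussBound_charpoly_of_elementaryDivisors hs hsd a).2 (p ^ n) B'
    (by exact_mod_cast hap) hBB'
  -- The unit coefficient in degree `k = L - ε₀` bounds the peak from below by `‖℘‖ ^ (a k)`.
  have hM := hB.bound k
  rw [hk1, one_mul, ← Real.rpow_natCast, ← Real.rpow_mul norm_wp_pos.le] at hM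
  have hpos := Real.rpow_pos_of_pos (norm_wp_pos (P := P)) (a : ℝ)
  have hlt := exponent_lt (L := L) hd₀ ha0 hap hp0 haC₂
  have hkL : (L : ℝ) - ε₀ = k := by
    rw [← hk, ← hε₀]; push_cast; ring
  rw [hkL] at hlt
  -- The peak of `B` is also a peak of `B'`; by uniqueness both ends agree, and so do the widths,
  -- which are the two multiplicities.
  have := (hB.perturb hpos hd (lt_of_lt_of_le
    (Real.rpow_lt_rpow_of_exponent_gt norm_wp_pos norm_wp_lt_one (by exact_mod_cast hlt))
    hM)).unique hB'
  omega
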